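/- Let $\mathfrak g$ be a finite-dimensional complex semisimple Lie algebra with Cartan subalgebra $\mathfrak h$ whose root system $\Phi$ is irreducible, let $\Delta\subset\Phi^+\subset\Phi$ be a set of simple roots and the corresponding set of positive roots, let $\mathfrak n=\bigoplus_{\alpha\in\Phi^+}\mathfrak g_\alpha$ be the nilradical of the corresponding Borel subalgebra, and let $N=\exp(\operatorname{ad}\mathfrak n)$ be the corresponding unipotent group, acting on $\mathfrak n^*$ by the coadjoint action $(g\cdot f)(x)=f(\operatorname{Ad}(g^{-1})x)$. Let $\{e_\alpha,\ \alpha\in\Phi^+\}$ be a basis of $\mathfrak n$ with $e_\alpha\in\mathfrak g_\alpha$, and let $\{e_\alpha^*,\ \alpha\in\Phi^+\}$ be the dual basis of $\mathfrak n^*$. For $D\subset\Phi^+$ and $\xi\colon D\to\mathbb C^\times$ put $f_{D,\xi}=\sum_{\beta\in D}\xi(\beta)e_\beta^*\in\mathfrak n^*$, and let $\Omega_{D,\xi}$ be the coadjoint $N$-orbit of $f_{D,\xi}$. For $\alpha,\beta\in\Phi^+$ we say that $\alpha$ is singular for $\beta$ if $\beta=\alpha+\gamma$ for some $\gamma\in\Phi^+$,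 and we write $\alpha<\beta$ if $\beta-\alpha$ is a nonempty sum of positive roots. Let $(\cdot,\cdot)$ be the inner product on the real span of $\Phi$ that is invariant under the Weyl group (unique up to a positive scalar). Let $D\subset\Phi^+$ be a subset such that $\beta_1$ is not singular for $\beta_2$ for all $\beta_1,\beta_2\in D$. Let $\beta_0\in D$, and let $\xi_1,\xi_2\colon D\to\mathbb C^\times$ be maps with $\xi_1(\beta_0)\neq\xi_2(\beta_0)$. Fix a total order $\leq_t$ on $\{e_\alpha,\ \alpha\in\Phi^+\}$ such that $\alpha>\beta$ implies $e_\alpha<_t e_\beta$. Assume that there is a simple root $\alpha_0\in\Delta$ with $(\alpha_0,\beta_0)\neq0$ and $(\alpha_0,\beta)=0$ for all $\beta\in D$ such that $e_\beta<_t e_{\beta_0}$. Then $\Omega_{D,\xi_1}\neq\Omega_{D,\xi_2}$. -/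

import Mathlib

namespace CoadjointOrbit

open LieAlgebra LieAlgebra.IsKilling Module

noncomputable section

variable {L : Type*} [LieRing L] [LieAlgebra ℂ L] [FiniteDimensional ℂ L] [IsKilling ℂ L]
  {H : LieSubalgebra ℂ L} [H.IsCartanSubalgebra]

/-- The positive roots of `L` with respect to the Cartan subalgebra `H` and the base `b`. -/
abbrev PosRoot (b : (rootSystem H).Base) : Type _ := {α : H.root // b.IsPos α}

/-- A positive root, as a linear form on `H`. -/
def PosRoot.toDual {b : (rootSystem H).Base} (α : PosRoot b) : Dual ℂ H :=
  (rootSystem H).root α.1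

/-- The simple roots among the positive roots. -/
def PosRoot.IsSimple {b : (rootSystem H).Base} (α : PosRoot b) : Prop := α.1 ∈ b.support

/-- The inner product of two roots, given by the canonical Weyl-invariant form
`(x, y) = ∑ γ, x(γ^∨) y(γ^∨)` on the dual of the Cartan subalgebra. -/
def PosRoot.inner {b : (rootSystem H).Base} (α β : PosRoot b) : ℂ :=
  (rootSystem H).RootForm α.toDual β.toDual

/-- The natural partial order: `α < β` when `β - α` is a sum of one or more positive roots. -/
def PosRoot.Below {b : (rootSystem H).Base} (α β : PosRoot b) : Prop :=
  α ≠ β ∧ β.toDual - α.toDual ∈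
    AddSubmonoid.closure (Set.range (PosRoot.toDual : PosRoot b → Dual ℂ H))

/-- `α` is singular for `β`: there is a positive root `γ` with `β = α + γ`. -/
def PosRoot.IsSingularFor {b : (rootSystem H).Base} (α β : PosRoot b) : Prop :=
  ∃ γ : PosRoot b, β.toDual = α.toDual + γ.toDual

theorem lie_mem_iSup_rootSpace (b : (rootSystem H).Base) {x y : L}
    (hx : x ∈ ⨆ α : PosRoot b, (rootSpace H α.toDual).toSubmodule)
    (hy : y ∈ ⨆ α : PosRoot b, (rootSpace H α.toDual).toSubmodule) :
    ⁅x, y⁆ ∈ ⨆ α : PosRoot b, (rootSpace H α.toDual).toSubmodule := by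
  induction hx using Submodule.iSup_induction' with
  | zero => simp
  | add u v _ _ hu hv => rw [add_lie]; exact add_mem hu hv
  | mem α u hu =>
    induction hy using Submodule.iSup_induction' with
    | zero => simp
    | add v w _ _ hv hw => rw [lie_add]; exact add_mem hv hw
    | mem β v hv =>
      have huv : ⁅u, v⁆ ∈ rootSpace H (⇑α.toDual + ⇑β.toDual) :=
        lie_mem_genWeightSpace_of_mem_genWeightSpace hu hv
      by_cases h0 : rootSpace H (⇑α.toDual + ⇑β.toDual) = ⊥
      · rw [h0, LieSubmodule.mem_bot] at huv
        rw [huv]; exact zero_mem _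
      · let χ : LieModule.Weight ℂ H L := ⟨_, h0⟩
        have hsum : α.toDual + β.toDual ≠ 0 := by
          intro h
          have h1 := α.2
          have h2 := β.2
          have h3 : α.1 = (rootSystem H).reflectionPerm β.1 β.1 := by
            apply (rootSystem H).root.injective
            rw [RootPairing.root_reflectionPerm, RootPairing.reflection_apply_self]
            exact eq_neg_of_add_eq_zero_left h
          rw [RootPairing.Base.isPos_iff] at h1 h2
          rw [h3, show b.height ((rootSystem H).reflectionPerm β.1 β.1) = - b.height β.1 from
            RootPairing.Base.height_reflectionPerm_self b β.1] at h1
          lia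
        have hχ : χ.IsNonZero := by
          intro h
          apply hsum
          ext z
          exact congrFun h z
        let γ : H.root := ⟨χ, by simpa using hχ⟩
        have hγ : (rootSystem H).root γ = α.toDual + β.toDual := by
          ext z; rfl
        let δ : PosRoot b := ⟨γ, RootPairing.Base.IsPos.add α.2 β.2 hγ⟩
        refine Submodule.mem_iSup_of_mem δ ?_
        change ⁅u, v⁆ ∈ rootSpace H ⇑((rootSystem H).root γ)
        rw [hγ]
        exact huv

/-- The nilradical `𝔫` of the Borel subalgebra attached to `H` and `b`:
the sum of the positive root spaces. -/
def nilrad (b : (rootSystem H).Base) : LieSubalgebra ℂ L where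
  toSubmodule := ⨆ α : PosRoot b, (rootSpace H α.toDual).toSubmodule
  lie_mem' hx hy := lie_mem_iSup_rootSpace b hx hy

/-- The exponential `∑ aⁱ / i!` of a nilpotent operator. -/
def expNilpotent {V : Type*} [AddCommGroup V] [Module ℂ V] (a : End ℂ V) : End ℂ V :=
  ∑ i ∈ Finset.range (nilpotencyClass a), (i.factorial : ℂ)⁻¹ • a ^ i

/-- The unipotent group `N = exp (ad 𝔫)`, as the subgroup of `GL(L)` generated by the
exponentials of the (nilpotent) operators `ad x` with `x ∈ 𝔫`. -/
def unipotentGroup (b : (rootSystem H).Base) : Subgroup (L ≃ₗ[ℂ] L) :=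
  Subgroup.closure {g | ∃ x ∈ nilrad b, (g : L →ₗ[ℂ] L) = expNilpotent (LieAlgebra.ad ℂ L x)}

theorem map_nilrad_eq (b : (rootSystem H).Base) {g : L ≃ₗ[ℂ] L} (hg : g ∈ unipotentGroup b) :
    (nilrad b).toSubmodule.map (g : L →ₗ[ℂ] L) = (nilrad b).toSubmodule := by
  induction hg using Subgroup.closure_induction with
  | mem g hg =>
    obtain ⟨x, hx, hgx⟩ := hg
    apply Submodule.eq_of_le_of_finrank_eq
    · rintro _ ⟨y, hy, rfl⟩
      rw [hgx, expNilpotent, LinearMap.sum_apply]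
      refine sum_mem fun i hir => ?_
      clear hir
      have hi : ((LieAlgebra.ad ℂ L x) ^ i) y ∈ (nilrad b).toSubmodule := by
        induction i with
        | zero => simpa using hy
        | succ i ih =>
          rw [pow_succ', Module.End.mul_apply]
          exact (nilrad b).lie_mem hx ih
      rw [LinearMap.smul_apply]
      exact Submodule.smul_mem _ _ hi
    · exact LinearEquiv.finrank_map_eq g _
  | one => exact Submodule.map_id _
  | mul g h _ _ hg hh =>
    calc (nilrad b).toSubmodule.map ((g * h : L ≃ₗ[ℂ] L) : L →ₗ[ℂ] L)
        = ((nilrad b).toSubmodule.map (h : L →ₗ[ℂ] L)).map (g : L →ₗ[ℂ] L) :=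
          Submodule.map_comp _ _ _
      _ = _ := by rw [hh, hg]
  | inv g _ hg =>
    calc (nilrad b).toSubmodule.map ((g⁻¹ : L ≃ₗ[ℂ] L) : L →ₗ[ℂ] L)
        = ((nilrad b).toSubmodule.map (g : L →ₗ[ℂ] L)).map ((g⁻¹ : L ≃ₗ[ℂ] L) : L →ₗ[ℂ] L) := by
          rw [hg]
      _ = (nilrad b).toSubmodule.map (((g⁻¹ * g : L ≃ₗ[ℂ] L)) : L →ₗ[ℂ] L) :=
          (Submodule.map_comp _ _ _).symm
      _ = _ := by rw [inv_mul_cancel]; exact Submodule.map_id _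

/-- The adjoint action of `N` on `𝔫`. -/
def Ad (b : (rootSystem H).Base) (g : unipotentGroup b) : nilrad b ≃ₗ[ℂ] nilrad b :=
  (g : L ≃ₗ[ℂ] L).ofSubmodules (nilrad b).toSubmodule (nilrad b).toSubmodule
    (map_nilrad_eq b g.2)

/-- The coadjoint action of `N` on `𝔫*`: `(g · f)(x) = f(Ad(g⁻¹) x)`. -/
def coadjoint (b : (rootSystem H).Base) (g : unipotentGroup b) (f : Dual ℂ (nilrad b)) :
    Dual ℂ (nilrad b) :=
  f ∘ₗ (Ad b g⁻¹ : nilrad b →ₗ[ℂ] nilrad b)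

/-- The coadjoint `N`-orbit of a linear form on `𝔫`. -/
def coadjointOrbit (b : (rootSystem H).Base) (f : Dual ℂ (nilrad b)) :
    Set (Dual ℂ (nilrad b)) :=
  Set.range fun g : unipotentGroup b => coadjoint b g f

/-- A basis of `𝔫` indexed by the positive roots consists of root vectors. -/
def IsRootVectorBasis (b : (rootSystem H).Base) (e : Basis (PosRoot b) ℂ (nilrad b)) : Prop :=
  ∀ α : PosRoot b, (e α : L) ∈ rootSpace H α.toDual

/-- The linear form `f_{D,ξ} = ∑_{β ∈ D} ξ(β) e_β^*`, where `e^*` is the basis dual to `e`. -/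
def linearForm {b : (rootSystem H).Base} (e : Basis (PosRoot b) ℂ (nilrad b))
    (D : Finset (PosRoot b)) (ξ : D → ℂˣ) : Dual ℂ (nilrad b) :=
  ∑ β : D, (ξ β : ℂ) • e.coord β

end

end CoadjointOrbit

namespace CoadjointOrbit

open LieAlgebra LieAlgebra.IsKilling Module

/-! ### The group `N` acts by Lie automorphisms, unitriangularly. -/

section

variable {L : Type*} [LieRing L] [LieAlgebra ℂ L]

/-! Suppose `g · f₁ = f₂`. Then `f₂ = f₁ ∘ k` on `𝔫`, where `k = Ad(g⁻¹)` is a Lie automorphism of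
all of `L` and so also acts on `𝔥`. Let `h ∈ 𝔥` represent `(α₀, ·)`, let `w = e β₀`, and let `U` be
the ideal of `𝔫` spanned by the root vectors preceding `w`. By unitriangularity
(`unipotentGroup_apply_sub_mem`), `k h = h + p` and `k w = w + q` with `p ∈ 𝔫`, `q ∈ U`. Hence
`f₂([h, w]) = f₁([h + p, w + q])`, and every term but `f₁([h, w])` vanishes: `[p, w]` by
non-singularity, `[h, q]` because `h` kills the earlier roots of `D`, `[p, q]` by comparing `f₁` and
`f₂` on `[𝔫, w]`. Since `[h, w] = β₀(h) w` with `β₀(h) ≠ 0`, `ξ₁` and `ξ₂` agree at `β₀`. -/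

/-- An invertible exponential of an operator `ad x` is a Lie algebra automorphism. -/
theorem map_lie_of_eq_expNilpotent {x : L} {g : L ≃ₗ[ℂ] L}
    (hg : (g : L →ₗ[ℂ] L) = expNilpotent (LieAlgebra.ad ℂ L x)) (u v : L) :
    g ⁅u, v⁆ = ⁅g u, g v⁆ := by
  rcases subsingleton_or_nontrivial L with hL | hL
  · exact Subsingleton.elim _ _
  -- `nilpotencyClass` is `0` on a non-nilpotent operator; the exponential would then be an empty
  -- sum, and `g = 0` is not injective.
  have hnil : IsNilpotent (LieAlgebra.ad ℂ L x) := by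
    apply isNilpotent_of_pos_nilpotencyClass
    rw [Nat.pos_iff_ne_zero]
    intro h0
    obtain ⟨w, hw⟩ := exists_ne (0 : L)
    refine hw (g.injective ?_)
    rw [map_zero, ← LinearEquiv.coe_coe, hg, expNilpotent, h0]
    simp
  let _ : LieAlgebra ℚ L := LieAlgebra.RestrictScalars.lieAlgebra ℚ ℂ L
  have key : (g : L →ₗ[ℂ] L) = IsNilpotent.exp (LieAlgebra.ad ℂ L x) := by
    rw [hg, expNilpotent, IsNilpotent.exp]
    refine Finset.sum_congr rfl fun i _ => ?_
    rw [← Rat.cast_smul_eq_qsmul ℂ]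
    simp
  let d : LieDerivation ℂ L L := LieDerivation.ad ℂ L x
  have hd : d.toLinearMap = LieAlgebra.ad ℂ L x := by
    ext y; simp [d]
  have hexp : ∀ w, g w = LieDerivation.exp d (hd ▸ hnil) w := by
    intro w
    rw [LieDerivation.exp_map_apply, hd, ← key]
    rfl
  simp only [hexp, LieEquiv.map_lie]

end

variable {L : Type*} [LieRing L] [LieAlgebra ℂ L] [FiniteDimensional ℂ L] [IsKilling ℂ L]
  {H : LieSubalgebra ℂ L} [H.IsCartanSubalgebra] {b : (rootSystem H).Base}

theorem unipotentGroup_map_lie {g : L ≃ₗ[ℂ] L} (hg : g ∈ unipotentGroup b) (u v : L) :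
    g ⁅u, v⁆ = ⁅g u, g v⁆ := by
  induction hg using Subgroup.closure_induction generalizing u v with
  | mem g hg =>
    obtain ⟨x, -, hgx⟩ := hg
    exact map_lie_of_eq_expNilpotent hgx u v
  | one => rfl
  | mul g h _ _ hg hh => simp only [LinearEquiv.mul_apply, hg, hh]
  | inv g _ hg =>
    apply g.injective
    rw [hg]
    simp only [← LinearEquiv.mul_apply, mul_inv_cancel]
    rfl

/-- If `U` is stable under `ad 𝔫` and `ad 𝔫` moves `v` into `U`, then `N` moves `v` only
by elements of `U`. -/
theorem unipotentGroup_apply_sub_mem {U : Submodule ℂ L}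
    (hU : ∀ x ∈ nilrad b, ∀ u ∈ U, ⁅x, u⁆ ∈ U)
    {g : L ≃ₗ[ℂ] L} (hg : g ∈ unipotentGroup b) {v : L} (hv : ∀ x ∈ nilrad b, ⁅x, v⁆ ∈ U) :
    g v - v ∈ U := by
  induction hg using Subgroup.closure_induction generalizing v with
  | mem g hg =>
    obtain ⟨x, hx, hgx⟩ := hg
    have hpow (i : ℕ) : ((LieAlgebra.ad ℂ L x) ^ (i + 1)) v ∈ U := by
      induction i with
      | zero => simpa using hv x hx
      | succ i ih =>
        rw [pow_succ', Module.End.mul_apply]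
        exact hU x hx _ ih
    rw [← LinearEquiv.coe_coe, hgx, expNilpotent]
    rcases h : nilpotencyClass (LieAlgebra.ad ℂ L x) with _ | k
    · have h0 : v = 0 := by
        apply g.injective
        rw [map_zero, ← LinearEquiv.coe_coe, hgx, expNilpotent, h]
        simp
      simp [h0]
    · rw [Finset.sum_range_succ', LinearMap.add_apply, LinearMap.sum_apply]
      simp only [pow_zero, Nat.factorial_zero, Nat.cast_one, inv_one, one_smul,
        Module.End.one_apply, add_sub_cancel_right]
      exact sum_mem fun i _ => U.smul_mem _ (hpow i)
  | one => simp
  | mul g h _ _ hg hh =>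
    -- `ghv - v = (g - 1)(hv - v) + (hv - v) + (gv - v)`.
    have h1 := hh hv
    have h2 := add_mem (hg (v := h v - v) fun x hx => hU x hx _ h1) h1
    have h3 := add_mem h2 (hg hv)
    simpa using h3
  | inv g hgm hg =>
    -- `g` maps `U` into itself, hence onto itself by dimension; so `gv - v = gu` with `u ∈ U`, and
    -- `g⁻¹v - v = -u`.
    have hUg : U ≤ U.comap (g : L →ₗ[ℂ] L) := fun u hu => by
      have := add_mem (hg (v := u) fun x hx => hU x hx u hu) hu
      simpa using this
    have hmap : U.map (g : L →ₗ[ℂ] L) = U :=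
      Submodule.eq_of_le_of_finrank_eq (Submodule.map_le_iff_le_comap.2 hUg)
        (LinearEquiv.finrank_map_eq g _)
    have hgv := hg hv
    rw [← hmap] at hgv
    obtain ⟨u, hu, huv⟩ := hgv
    have : (g⁻¹ : L ≃ₗ[ℂ] L) v - v = -u := by
      apply g.injective
      rw [map_sub, map_neg, ← LinearEquiv.mul_apply, mul_inv_cancel,
        show g u = g v - v from huv]
      simp
    rw [this]
    exact neg_mem hu

/-! ### Root vectors in `𝔫` and the values of `f_{D,ξ}` on them. -/

theorem mem_nilrad_of_mem_rootSpace {α : PosRoot b} {u : L} (hu : u ∈ rootSpace H α.toDual) :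
    u ∈ nilrad b :=
  Submodule.mem_iSup_of_mem (p := fun α : PosRoot b => (rootSpace H α.toDual).toSubmodule) α hu

/-- To prove an additive property of all elements of `𝔫` it suffices to consider root vectors. -/
theorem nilrad_induction {p : L → Prop}
    (of_root : ∀ (α : PosRoot b), ∀ u ∈ rootSpace H α.toDual, p u) (of_zero : p 0)
    (of_add : ∀ u v, p u → p v → p (u + v)) {x : L} (hx : x ∈ nilrad b) : p x :=
  Submodule.iSup_induction (fun α : PosRoot b => (rootSpace H α.toDual).toSubmodule)
    (motive := p) hx of_root of_zero of_add

theorem lie_mem_rootSpace_add {α β : PosRoot b} {u v : L}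
    (hu : u ∈ rootSpace H α.toDual) (hv : v ∈ rootSpace H β.toDual) :
    ⁅u, v⁆ = 0 ∨ ∃ δ : PosRoot b, δ.toDual = α.toDual + β.toDual ∧
      ⁅u, v⁆ ∈ rootSpace H δ.toDual := by
  have huv : ⁅u, v⁆ ∈ rootSpace H (⇑α.toDual + ⇑β.toDual) :=
    lie_mem_genWeightSpace_of_mem_genWeightSpace hu hv
  by_cases h0 : rootSpace H (⇑α.toDual + ⇑β.toDual) = ⊥
  · rw [h0, LieSubmodule.mem_bot] at huv
    exact .inl huv
  right
  let χ : LieModule.Weight ℂ H L := ⟨_, h0⟩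
  -- Positive roots have positive height, so `α = -β` is impossible.
  have hsum : α.toDual + β.toDual ≠ 0 := by
    intro h
    have h1 := α.2
    have h2 := β.2
    have h3 : α.1 = (rootSystem H).reflectionPerm β.1 β.1 := by
      apply (rootSystem H).root.injective
      rw [RootPairing.root_reflectionPerm, RootPairing.reflection_apply_self]
      exact eq_neg_of_add_eq_zero_left h
    rw [RootPairing.Base.isPos_iff] at h1 h2
    rw [h3, show b.height ((rootSystem H).reflectionPerm β.1 β.1) = - b.height β.1 from
      RootPairing.Base.height_reflectionPerm_self b β.1] at h1
    lia
  have hχ : χ.IsNonZero := by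
    intro h
    apply hsum
    ext z
    exact congrFun h z
  let γ : H.root := ⟨χ, by simpa using hχ⟩
  have hγ : (rootSystem H).root γ = α.toDual + β.toDual := by
    ext z; rfl
  refine ⟨⟨γ, RootPairing.Base.IsPos.add α.2 β.2 hγ⟩, hγ, ?_⟩
  change ⁅u, v⁆ ∈ rootSpace H ⇑((rootSystem H).root γ)
  rw [hγ]
  exact huv

theorem PosRoot.toDual_ne_zero (α : PosRoot b) : α.toDual ≠ 0 :=
  (rootSystem H).ne_zero α.1

theorem PosRoot.below_of_toDual_eq_add {α β δ : PosRoot b}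
    (h : δ.toDual = α.toDual + β.toDual) : β.Below δ := by
  refine ⟨fun hβ => α.toDual_ne_zero ?_, ?_⟩
  · rwa [hβ, right_eq_add] at h
  · rw [h, add_sub_cancel_right]
    exact AddSubmonoid.subset_closure ⟨α, rfl⟩

/-- Root spaces are one-dimensional. -/
theorem exists_smul_eq_of_mem_rootSpace {e : Basis (PosRoot b) ℂ (nilrad b)}
    (he : IsRootVectorBasis b e) {γ : PosRoot b} {u : nilrad b}
    (hu : (u : L) ∈ rootSpace H γ.toDual) : ∃ c : ℂ, c • e γ = u := by
  have h1 : finrank ℂ (rootSpace H γ.toDual) = 1 :=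
    finrank_rootSpace_eq_one γ.1.1 (Finset.mem_filter.1 γ.1.2).2
  have hne : (⟨(e γ : L), he γ⟩ : rootSpace H γ.toDual) ≠ 0 := by
    intro h
    apply e.ne_zero γ
    exact Subtype.ext (congrArg (fun y : rootSpace H γ.toDual => (y : L)) h)
  obtain ⟨c, hc⟩ := (finrank_eq_one_iff_of_nonzero' _ hne).1 h1 ⟨u, hu⟩
  exact ⟨c, Subtype.ext (congrArg (fun y : rootSpace H γ.toDual => (y : L)) hc)⟩

theorem linearForm_basis_of_mem (e : Basis (PosRoot b) ℂ (nilrad b))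
    {D : Finset (PosRoot b)} (ξ : D → ℂˣ) {γ : PosRoot b} (hγ : γ ∈ D) :
    linearForm e D ξ (e γ) = ξ ⟨γ, hγ⟩ := by
  classical
  rw [linearForm, LinearMap.sum_apply, Finset.sum_eq_single ⟨γ, hγ⟩]
  · simp
  · intro β _ hβ
    have : γ ≠ β.1 := fun h => hβ (Subtype.ext h.symm)
    simp [Finsupp.single_eq_of_ne' this]
  · simp

theorem linearForm_apply_eq_zero {e : Basis (PosRoot b) ℂ (nilrad b)}
    (he : IsRootVectorBasis b e) {D : Finset (PosRoot b)} (ξ : D → ℂˣ) {γ : PosRoot b}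
    (hγ : γ ∉ D) {u : nilrad b} (hu : (u : L) ∈ rootSpace H γ.toDual) :
    linearForm e D ξ u = 0 := by
  classical
  obtain ⟨c, rfl⟩ := exists_smul_eq_of_mem_rootSpace he hu
  rw [linearForm, LinearMap.sum_apply]
  refine Finset.sum_eq_zero fun β _ => ?_
  have : γ ≠ β.1 := fun h => hγ (h ▸ β.2)
  simp [Finsupp.single_eq_of_ne' this]

/-! ### The orbit invariant. -/

/-- If some `h ∈ 𝔥` satisfies `β₀(h) ≠ 0` and `β(h) = 0` for all `β ∈ D` preceding `β₀`, then
the value of `ξ` at `β₀` is an invariant of the coadjoint orbit of `f_{D,ξ}`. -/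
theorem eq_of_coadjoint_linearForm_eq {e : Basis (PosRoot b) ℂ (nilrad b)}
    (he : IsRootVectorBasis b e) {D : Finset (PosRoot b)}
    (hD : ∀ β₁ ∈ D, ∀ β₂ ∈ D, ¬ β₁.IsSingularFor β₂) {β₀ : PosRoot b} (hβ₀ : β₀ ∈ D)
    {lt : PosRoot b → PosRoot b → Prop} (hlt : ∀ α β γ, lt α β → lt β γ → lt α γ)
    (ht : ∀ α β : PosRoot b, β.Below α → lt α β) {h : H} (h₀ : β₀.toDual h ≠ 0)
    (hh : ∀ β ∈ D, lt β β₀ → β.toDual h = 0) {ξ₁ ξ₂ : D → ℂˣ} {g : unipotentGroup b}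
    (hg : coadjoint b g (linearForm e D ξ₁) = linearForm e D ξ₂) :
    ξ₁ ⟨β₀, hβ₀⟩ = ξ₂ ⟨β₀, hβ₀⟩ := by
  -- Extending the forms to `L` lets them be applied to brackets without carrying membership in `𝔫`.
  obtain ⟨F₁, hF₁⟩ := LinearMap.exists_extend (p := (nilrad b).toSubmodule) (linearForm e D ξ₁)
  obtain ⟨F₂, hF₂⟩ := LinearMap.exists_extend (p := (nilrad b).toSubmodule) (linearForm e D ξ₂)
  replace hF₁ (u : nilrad b) : F₁ u = linearForm e D ξ₁ u := LinearMap.congr_fun hF₁ u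
  replace hF₂ (u : nilrad b) : F₂ u = linearForm e D ξ₂ u := LinearMap.congr_fun hF₂ u
  obtain ⟨k, hk, hF⟩ : ∃ k ∈ unipotentGroup b, ∀ x ∈ nilrad b, F₂ x = F₁ (k x) := by
    refine ⟨(g⁻¹ : unipotentGroup b), (g⁻¹).2, fun x hx => ?_⟩
    rw [hF₂ ⟨x, hx⟩, ← hg]
    exact (hF₁ (Ad b g⁻¹ ⟨x, hx⟩)).symm
  set w : L := (e β₀ : L) with hw
  have hwβ : w ∈ rootSpace H β₀.toDual := he β₀
  have hwn : w ∈ nilrad b := (e β₀).2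
  -- The ideal of `𝔫` spanned by the root vectors preceding `e β₀`.
  let U : Submodule ℂ L := ⨆ γ : {γ : PosRoot b // lt γ β₀}, (rootSpace H γ.1.toDual).toSubmodule
  have hUmem {γ : PosRoot b} (hγ : lt γ β₀) {u : L} (hu : u ∈ rootSpace H γ.toDual) : u ∈ U :=
    Submodule.mem_iSup_of_mem
      (p := fun γ : {γ : PosRoot b // lt γ β₀} => (rootSpace H γ.1.toDual).toSubmodule) ⟨γ, hγ⟩ hu
  have hUind {p : L → Prop} (of_root : ∀ γ : PosRoot b, lt γ β₀ → ∀ u ∈ rootSpace H γ.toDual, p u)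
      (of_zero : p 0) (of_add : ∀ u v, p u → p v → p (u + v)) {x : L} (hx : x ∈ U) : p x :=
    Submodule.iSup_induction
      (fun γ : {γ : PosRoot b // lt γ β₀} => (rootSpace H γ.1.toDual).toSubmodule)
      (motive := p) hx (fun γ => of_root γ.1 γ.2) of_zero of_add
  have hU : ∀ x ∈ nilrad b, ∀ u ∈ U, ⁅x, u⁆ ∈ U := by
    intro x hx u hu
    refine nilrad_induction (p := fun x => ⁅x, u⁆ ∈ U) (fun α x hx => ?_) (by simp)
      (fun x y hx hy => by rw [add_lie]; exact add_mem hx hy) hx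
    refine hUind (p := fun u => ⁅x, u⁆ ∈ U) (fun γ hγ u hu => ?_) (by simp)
      (fun u v hu hv => by rw [lie_add]; exact add_mem hu hv) hu
    obtain h0 | ⟨δ, hδ, hxu⟩ := lie_mem_rootSpace_add hx hu
    · rw [h0]; exact zero_mem _
    · exact hUmem (hlt _ _ _ (ht _ _ (PosRoot.below_of_toDual_eq_add hδ)) hγ) hxu
  have hwU : ∀ x ∈ nilrad b, ⁅x, w⁆ ∈ U := by
    intro x hx
    refine nilrad_induction (p := fun x => ⁅x, w⁆ ∈ U) (fun α x hx => ?_) (by simp)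
      (fun x y hx hy => by rw [add_lie]; exact add_mem hx hy) hx
    obtain h0 | ⟨δ, hδ, hxu⟩ := lie_mem_rootSpace_add hx hwβ
    · rw [h0]; exact zero_mem _
    · exact hUmem (ht _ _ (PosRoot.below_of_toDual_eq_add hδ)) hxu
  -- A root `α + β₀` lies outside `D`, as `β₀` is not singular for any member of `D`.
  have hxw {F : L →ₗ[ℂ] ℂ} {ξ : D → ℂˣ} (hFξ : ∀ u : nilrad b, F u = linearForm e D ξ u) :
      ∀ x ∈ nilrad b, F ⁅x, w⁆ = 0 := by
    intro x hx
    refine nilrad_induction (p := fun x => F ⁅x, w⁆ = 0) (fun α x hx => ?_) (by simp)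
      (fun x y hx hy => by rw [add_lie, map_add, hx, hy, add_zero]) hx
    obtain h0 | ⟨δ, hδ, hxu⟩ := lie_mem_rootSpace_add hx hwβ
    · rw [h0, map_zero]
    · rw [hFξ ⟨_, mem_nilrad_of_mem_rootSpace hxu⟩]
      refine linearForm_apply_eq_zero he ξ (fun hδD => ?_) hxu
      exact hD _ hβ₀ _ hδD ⟨α, by rw [hδ, add_comm]⟩
  have hhU : ∀ u ∈ U, F₁ ⁅(h : L), u⁆ = 0 := by
    intro u hu
    refine hUind (p := fun u => F₁ ⁅(h : L), u⁆ = 0) (fun γ hγ u hu => ?_) (by simp)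
      (fun u v hu hv => by rw [lie_add, map_add, hu, hv, add_zero]) hu
    have hhu : ⁅(h : L), u⁆ = γ.toDual h • u := lie_eq_smul_of_mem_rootSpace hu h
    rw [hhu, map_smul]
    by_cases hγD : γ ∈ D
    · rw [hh γ hγD hγ, zero_smul]
    · rw [hF₁ ⟨u, mem_nilrad_of_mem_rootSpace hu⟩, linearForm_apply_eq_zero he ξ₁ hγD hu,
        smul_zero]
  have hhn : ∀ x ∈ nilrad b, ⁅x, (h : L)⁆ ∈ (nilrad b).toSubmodule := by
    intro x hx
    refine nilrad_induction (p := fun x => ⁅x, (h : L)⁆ ∈ (nilrad b).toSubmodule)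
      (fun α x hx => ?_) (by simp)
      (fun x y hx hy => by rw [add_lie]; exact add_mem hx hy) hx
    have hhx : ⁅(h : L), x⁆ = α.toDual h • x := lie_eq_smul_of_mem_rootSpace hx h
    rw [← lie_skew, hhx]
    exact neg_mem (Submodule.smul_mem _ _ (mem_nilrad_of_mem_rootSpace hx))
  obtain ⟨q, hq, hkw⟩ : ∃ q ∈ U, k w = w + q :=
    ⟨_, unipotentGroup_apply_sub_mem hU hk hwU, by abel⟩
  obtain ⟨p, hp, hkh⟩ : ∃ p ∈ nilrad b, k h = h + p :=
    ⟨_, unipotentGroup_apply_sub_mem (U := (nilrad b).toSubmodule)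
      (fun x hx u hu => (nilrad b).lie_mem hx hu) hk hhn, by abel⟩
  -- Write `p = k y` with `y ∈ 𝔫`. Then `0 = F₂ [y, w] = F₁ [p, w + q]`, and `F₁ [p, w] = 0`.
  have hpq : F₁ ⁅p, q⁆ = 0 := by
    have hp' := hp
    rw [← LieSubalgebra.mem_toSubmodule, ← map_nilrad_eq b hk] at hp'
    obtain ⟨y, hy, rfl⟩ := hp'
    have h1 := hF _ ((nilrad b).lie_mem hy hwn)
    rw [hxw hF₂ y hy, unipotentGroup_map_lie hk, hkw, lie_add, map_add] at h1
    have h2 := hxw hF₁ _ hp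
    rw [LinearEquiv.coe_coe] at h2 ⊢
    rw [h2, zero_add] at h1
    exact h1.symm
  have hhw : ⁅(h : L), w⁆ = β₀.toDual h • w := lie_eq_smul_of_mem_rootSpace hwβ h
  have hval : F₂ ⁅(h : L), w⁆ = F₁ ⁅(h : L), w⁆ := by
    rw [hF _ (hhw ▸ (nilrad b).smul_mem _ hwn), unipotentGroup_map_lie hk, hkh, hkw, lie_add,
      add_lie, add_lie, map_add, map_add, map_add, hxw hF₁ p hp, hhU q hq, hpq]
    simp
  rw [hhw, map_smul, map_smul, hw, hF₁, hF₂, linearForm_basis_of_mem e _ hβ₀,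
    linearForm_basis_of_mem e _ hβ₀] at hval
  exact Units.ext (smul_right_injective ℂ h₀ hval).symm

theorem mem_coadjointOrbit_self (f : Dual ℂ (nilrad b)) : f ∈ coadjointOrbit b f := by
  refine ⟨1, ?_⟩
  ext x
  simp only [coadjoint, inv_one]
  rfl

end CoadjointOrbit

theorem proposition4p2 {L : Type*} [LieRing L] [LieAlgebra ℂ L] [FiniteDimensional ℂ L]
    [LieAlgebra.IsSemisimple ℂ L] (H : LieSubalgebra ℂ L) [H.IsCartanSubalgebra]
    (hirr : (LieAlgebra.IsKilling.rootSystem H).IsIrreducible)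
    (b : (LieAlgebra.IsKilling.rootSystem H).Base)
    (e : Module.Basis (CoadjointOrbit.PosRoot b) ℂ (CoadjointOrbit.nilrad b))
    (he : CoadjointOrbit.IsRootVectorBasis b e)
    (D : Finset (CoadjointOrbit.PosRoot b))
    (hD : ∀ β₁ ∈ D, ∀ β₂ ∈ D, ¬ β₁.IsSingularFor β₂)
    (β₀ : CoadjointOrbit.PosRoot b) (hβ₀ : β₀ ∈ D)
    (ξ₁ ξ₂ : D → ℂˣ) (hξ : ξ₁ ⟨β₀, hβ₀⟩ ≠ ξ₂ ⟨β₀, hβ₀⟩)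
    (t : LinearOrder (CoadjointOrbit.PosRoot b))
    (ht : ∀ α β : CoadjointOrbit.PosRoot b, β.Below α → t.lt α β)
    (hα₀ : ∃ α₀ : CoadjointOrbit.PosRoot b, α₀.IsSimple ∧ α₀.inner β₀ ≠ 0 ∧
      ∀ β ∈ D, t.lt β β₀ → α₀.inner β = 0) :
    CoadjointOrbit.coadjointOrbit b (CoadjointOrbit.linearForm e D ξ₁) ≠
      CoadjointOrbit.coadjointOrbit b (CoadjointOrbit.linearForm e D ξ₂) := by
  obtain ⟨α₀, -, h₀, hα⟩ := hα₀
  intro horb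
  have hmem := CoadjointOrbit.mem_coadjointOrbit_self (CoadjointOrbit.linearForm e D ξ₂)
  rw [← horb] at hmem
  obtain ⟨g, hg⟩ := hmem
  -- The element of `𝔥` at which each root `β` takes the value `(α₀, β)`.
  let h : H := (Module.evalEquiv ℂ H).symm ((LieAlgebra.IsKilling.rootSystem H).RootForm α₀.toDual)
  have hh (β : CoadjointOrbit.PosRoot b) : β.toDual h = α₀.inner β :=
    Module.apply_evalEquiv_symm_apply ..
  refine hξ (CoadjointOrbit.eq_of_coadjoint_linearForm_eq he hD hβ₀ (lt := t.lt)
    (fun _ _ _ => @lt_trans _ t.toPreorder _ _ _) ht (h := h) ?_ ?_ hg)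
  · rwa [hh]
  · intro β hβ hlt
    rw [hh, hα β hβ hlt]
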